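/- All state spaces are finite, all chains run in discrete time $n\in\mathbb N=\{0,1,2,\dots\}$ and terminate almost surely. A terminating chain on $T$ with initial probability vector $\alpha$ and subprobability matrix $Q$ is sent from $i\in T$ to a cemetery state with probability $1-\sum_j Q_{ij}$; its termination time is the first $n\ge 1$ at which it is outside $T$. \emph{mDPH (bivariate).} Let $\beta$ be a probability vector and let $Q_1,Q_2$ be subprobability matrices on $S$. The mDPH law with parameters $(\beta,Q_1,Q_2)$ is the joint law of the termination times of two terminating chains on $S$ that start in the same state, drawn from $\beta$, and then evolve independently according to $Q_1$ and $Q_2$ respectively. \emph{CDPH.} Let $E,S$ be disjoint non-empty finite sets, $\alpha$ a probability vector on $E$, $P$ ($E\times E$) and $U$ ($E\times S$) nonnegative matrices such that each row of $(P\;U)$ sums to one, and $Q_1,Q_2$ subprobability matrices on $S$. Let $M_1$ be a terminating chain on $E\cup S$ with initial vector $(\alpha,0)$ and matrix $\begin{pmatrix}P&U\\0&Q_1\end{pmatrix}$, and let $\tau_{1,2}$ be the first $n\ge1$ with $M_1(n)\notin E$. Let $M_2(n)=M_1(n)$ for $n\le\tau_{1,2}$; given $\tau_{1,2}$, $M_1(\tau_{1,2})$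 and the trajectory of $M_1$, let $M_2$ evolve after time $\tau_{1,2}$ as a terminating chain on $S$ with matrix $Q_2$ started from $M_1(\tau_{1,2})$. Let $\tau_1,\tau_2$ be the termination times of $M_1,M_2$. The CDPH law with parameters $(\alpha,P,U,Q_1,Q_2)$ and support on $(c_1\mathbb N+k_1)\times(c_2\mathbb N+k_2)$ is the law of $(c_1(\tau_1-2)+k_1,\;c_2(\tau_2-2)+k_2)$. \emph{MDPH$^*$ (bivariate).} This is the class of joint laws of $\bigl(\sum_{\ell=0}^{\sigma-1}r_1(X(\ell)),\ \sum_{\ell=0}^{\sigma-1}r_2(X(\ell))\bigr)$, where $X$ is a terminating chain on a finite set $T$ with termination time $\sigma$ and $r_1,r_2:T\to\mathbb N$ are reward functions. \textbf{Proposition.} (1) Every bivariate mDPH law is a CDPH law with support on $(\mathbb N+1)\times(\mathbb N+1)$. More precisely, the mDPH law with parameters $(\beta,Q_1,Q_2)$ (for instance with $Q_1=Q_2$) is the CDPH law on this lattice with parameters $\alpha=(1)$, $P=(0)$, $U=\beta$, $Q_1$, $Q_2$. (2) Every CDPH law with support on $(\mathbb N+2)\times(\mathbb N+2)$ is a bivariate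 MDPH$^*$ law. More precisely, the CDPH law on this lattice with parameters $(\alpha,P,U,Q_1,Q_2)$ is the MDPH$^*$ law obtained from a terminating chain $\gamma$ on $E\cup(S\times S)\cup(\{\partial_1\}\times S)\cup(S\times\{\partial_2\})$ with initial vector $(\alpha,0,0,0)$ and subprobability matrix $$P_{\max}=\begin{pmatrix}P&U^*&0&0\\0&Q_1\otimes Q_2&q_1\otimes Q_2&Q_1\otimes q_2\\0&0&Q_2&0\\0&0&0&Q_1\end{pmatrix},$$ where $q_k=\mathbf 1-Q_k\mathbf 1$ and $u^*_{i,(j_1,j_2)}=u_{ij_1}\delta_{j_1j_2}$, with rewards $r_1=\mathbf 1_{E\cup(S\times S)\cup(S\times\{\partial_2\})}$ and $r_2=\mathbf 1_{E\cup(S\times S)\cup(\{\partial_1\}\times S)}$. -/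

import Mathlib

open MeasureTheory ProbabilityTheory Matrix
open scoped Kronecker

namespace PhaseType

/-! ### Terminating Markov chains

A terminating chain on a finite set `T` is a process with values in `Option T`; the value `none`
is the cemetery state `Δ`. -/

section Chains

variable {T Ω : Type*}

/-- The termination time `inf {n ≥ 1 : X(n) ∉ T}`, equal to `⊤` if there is no such `n`. -/
noncomputable def terminationTime (X : ℕ → Ω → Option T) : Ω → WithTop ℕ :=
  hittingAfter X {none} 1

/-- Initial probabilities `(α, 0)` on `T ∪ {Δ}`. -/
def initProb (α : T → ℝ) : Option T → ℝ
  | some i => α i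
  | none => 0

variable [Fintype T]

/-- Subprobability matrices: nonnegative entries, row sums at most one. -/
structure IsSubstochastic (Q : Matrix T T ℝ) : Prop where
  nonneg : ∀ i j, 0 ≤ Q i j
  sum_le_one : ∀ i, ∑ j, Q i j ≤ 1

/-- One-step termination probabilities `q = 1 - Q 1`. -/
def exitVec (Q : Matrix T T ℝ) (i : T) : ℝ := 1 - ∑ j, Q i j

/-- Transition probabilities on `T ∪ {Δ}` given by the block matrix `((Q, 1 - Q 1), (0, 1))`. -/
def stepProb (Q : Matrix T T ℝ) : Option T → Option T → ℝ
  | some i, some j => Q i j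
  | some i, none => exitVec Q i
  | none, some _ => 0
  | none, none => 1

/-- `X` is an almost surely terminating Markov chain on `T` with initial probability vector `α` and
subprobability matrix `Q`, under the measure `μ`. -/
structure IsTerminatingChain [MeasurableSpace Ω] (μ : Measure Ω) (α : T → ℝ) (Q : Matrix T T ℝ)
    (X : ℕ → Ω → Option T) : Prop where
  measurable : ∀ n x, MeasurableSet {ω | X n ω = x}
  law : ∀ (n : ℕ) (x : ℕ → Option T),
    μ {ω | ∀ k ≤ n, X k ω = x k} =
      ENNReal.ofReal (initProb α (x 0) * ∏ k ∈ Finset.range n, stepProb Q (x k) (x (k + 1)))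
  terminates : ∀ᵐ ω ∂μ, terminationTime X ω < ⊤

end Chains

/-! ### The class mDPH (bivariate) -/

section MDPH

variable {S : Type*} [Fintype S]

/-- Two terminating chains on `S` that start in the same state, drawn from `β`, and evolve
independently from there onwards according to `Q₁` and `Q₂`. -/
structure IsSameStartPair {Ω : Type*} [MeasurableSpace Ω] (μ : Measure Ω) (β : S → ℝ)
    (Q₁ Q₂ : Matrix S S ℝ) (X₁ X₂ : ℕ → Ω → Option S) : Prop where
  chain₁ : IsTerminatingChain μ β Q₁ X₁
  chain₂ : IsTerminatingChain μ β Q₂ X₂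
  law : ∀ (n₁ n₂ : ℕ) (i : S) (x₁ x₂ : ℕ → Option S), x₁ 0 = some i → x₂ 0 = some i →
    μ {ω | (∀ k ≤ n₁, X₁ k ω = x₁ k) ∧ (∀ k ≤ n₂, X₂ k ω = x₂ k)} =
      ENNReal.ofReal (β i * (∏ k ∈ Finset.range n₁, stepProb Q₁ (x₁ k) (x₁ (k + 1))) *
        ∏ k ∈ Finset.range n₂, stepProb Q₂ (x₂ k) (x₂ (k + 1)))

/-- `ν` is the bivariate mDPH law with parameters `β`, `Q₁`, `Q₂`. -/
def IsMDPHLaw (β : S → ℝ) (Q₁ Q₂ : Matrix S S ℝ) (ν : Measure (ℝ × ℝ)) : Prop :=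
  β ∈ stdSimplex ℝ S ∧ IsSubstochastic Q₁ ∧ IsSubstochastic Q₂ ∧
  ∃ (Ω : Type) (_ : MeasurableSpace Ω) (μ : Measure Ω) (_ : IsProbabilityMeasure μ)
    (X₁ X₂ : ℕ → Ω → Option S),
    IsSameStartPair μ β Q₁ Q₂ X₁ X₂ ∧
    HasLaw (fun ω => ((((terminationTime X₁ ω).untopD 0 : ℕ) : ℝ),
      (((terminationTime X₂ ω).untopD 0 : ℕ) : ℝ))) ν μ

/-- The class of bivariate mDPH laws. -/
def MDPH : Set (Measure (ℝ × ℝ)) :=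
  {ν | ∃ (S : Type) (_ : Fintype S) (β : S → ℝ) (Q₁ Q₂ : Matrix S S ℝ), IsMDPHLaw β Q₁ Q₂ ν}

end MDPH

/-! ### The class CDPH -/

section CDPH

variable {E S : Type*} [Fintype E] [Fintype S]

/-- Admissible parameters: `α` is a probability vector, `P` and `U` are nonnegative with each row
of `(P U)` summing to one, `Q₁` and `Q₂` are subprobability matrices. -/
structure IsCDPHParam (α : E → ℝ) (P : Matrix E E ℝ) (U : Matrix E S ℝ)
    (Q₁ Q₂ : Matrix S S ℝ) : Prop where
  init : α ∈ stdSimplex ℝ E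
  nonneg_P : ∀ i j, 0 ≤ P i j
  nonneg_U : ∀ i j, 0 ≤ U i j
  sum_row : ∀ i, ∑ j, P i j + ∑ j, U i j = 1
  sub₁ : IsSubstochastic Q₁
  sub₂ : IsSubstochastic Q₂

/-- The decoupling time `τ₁₂ = inf {n ≥ 1 : M(n) ∉ E}`. -/
noncomputable def decouplingTime {E S Ω : Type*} (M : ℕ → Ω → Option (E ⊕ S)) :
    Ω → WithTop ℕ :=
  hittingAfter M {x | ∀ i : E, x ≠ some (Sum.inl i)} 1

/-- The joint process `(M₁, M₂)` on `E ∪ S`. `M₁` is a terminating chain with initial vector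
`(α, 0)` and matrix `((P, U), (0, Q₁))`; `M₂` agrees with `M₁` up to and including `τ₁₂`; given
`τ₁₂ = m`, `M₁(m) = j ∈ S` and the trajectory of `M₁`, the process `M₂(m + ·)` is a terminating
chain in `S` with matrix `Q₂` started in `j`. -/
structure IsCommonShockPair {Ω : Type*} [MeasurableSpace Ω] (μ : Measure Ω) (α : E → ℝ)
    (P : Matrix E E ℝ) (U : Matrix E S ℝ) (Q₁ Q₂ : Matrix S S ℝ)
    (M₁ M₂ : ℕ → Ω → Option (E ⊕ S)) : Prop where
  chain₁ : IsTerminatingChain μ (Sum.elim α 0) (Matrix.fromBlocks P U 0 Q₁) M₁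
  measurable₂ : ∀ n x, MeasurableSet {ω | M₂ n ω = x}
  agree : ∀ᵐ ω ∂μ, ∀ n : ℕ, (n : WithTop ℕ) ≤ decouplingTime M₁ ω → M₂ n ω = M₁ n ω
  independent : ∀ (m N n : ℕ) (j : S) (y : ℕ → Option (E ⊕ S)) (z : ℕ → Option S), z 0 = some j →
    μ {ω | (decouplingTime M₁ ω = (m : WithTop ℕ) ∧ M₁ m ω = some (Sum.inr j) ∧
          ∀ k ≤ N, M₁ k ω = y k) ∧ ∀ k ≤ n, M₂ (m + k) ω = (z k).map Sum.inr} =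
      μ {ω | decouplingTime M₁ ω = (m : WithTop ℕ) ∧ M₁ m ω = some (Sum.inr j) ∧
          ∀ k ≤ N, M₁ k ω = y k} *
        ENNReal.ofReal (∏ k ∈ Finset.range n, stepProb Q₂ (z k) (z (k + 1)))
  terminates₂ : ∀ᵐ ω ∂μ, terminationTime M₂ ω < ⊤

/-- `ν` is the law of `(c₁ (τ₁ - 2) + k₁, c₂ (τ₂ - 2) + k₂)`, where `τ₁`, `τ₂` are the termination
times of a common shock pair with parameters `(α, P, U, Q₁, Q₂)`; that is, `ν` is the CDPH law with
these parameters and support on `(c₁ ℕ + k₁) × (c₂ ℕ + k₂)`. -/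
def IsCDPHLaw (c₁ k₁ c₂ k₂ : ℝ) (α : E → ℝ) (P : Matrix E E ℝ) (U : Matrix E S ℝ)
    (Q₁ Q₂ : Matrix S S ℝ) (ν : Measure (ℝ × ℝ)) : Prop :=
  IsCDPHParam α P U Q₁ Q₂ ∧
  ∃ (Ω : Type) (_ : MeasurableSpace Ω) (μ : Measure Ω) (_ : IsProbabilityMeasure μ)
    (M₁ M₂ : ℕ → Ω → Option (E ⊕ S)),
    IsCommonShockPair μ α P U Q₁ Q₂ M₁ M₂ ∧
    HasLaw (fun ω => (c₁ * ((((terminationTime M₁ ω).untopD 0 : ℕ) : ℝ) - 2) + k₁,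
      c₂ * ((((terminationTime M₂ ω).untopD 0 : ℕ) : ℝ) - 2) + k₂)) ν μ

/-- The class of CDPH laws with support on `(c₁ ℕ + k₁) × (c₂ ℕ + k₂)`. -/
def CDPH (c₁ k₁ c₂ k₂ : ℝ) : Set (Measure (ℝ × ℝ)) :=
  {ν | ∃ (E S : Type) (_ : Fintype E) (_ : Fintype S) (_ : Nonempty E) (_ : Nonempty S)
    (α : E → ℝ) (P : Matrix E E ℝ) (U : Matrix E S ℝ) (Q₁ Q₂ : Matrix S S ℝ),
    IsCDPHLaw c₁ k₁ c₂ k₂ α P U Q₁ Q₂ ν}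

end CDPH

/-! ### The class MDPH* (bivariate) -/

section MDPHStar

variable {T : Type*} [Fintype T]

/-- The reward `∑_{ℓ < σ} r(X(ℓ))` accumulated up to the termination time `σ` of `X`. -/
noncomputable def totalReward {T Ω : Type*} (r : T → ℕ) (X : ℕ → Ω → Option T) (ω : Ω) : ℕ :=
  ∑ ℓ ∈ Finset.range ((terminationTime X ω).untopD 0), (X ℓ ω).elim 0 r

/-- `ν` is the joint law of the total rewards, for the nonnegative integer reward functions `r₁` and
`r₂`, of a terminating Markov chain with initial vector `π` and subprobability matrix `Q`. -/
def IsMDPHStarLaw (π : T → ℝ) (Q : Matrix T T ℝ) (r₁ r₂ : T → ℕ) (ν : Measure (ℝ × ℝ)) : Prop :=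
  π ∈ stdSimplex ℝ T ∧ IsSubstochastic Q ∧
  ∃ (Ω : Type) (_ : MeasurableSpace Ω) (μ : Measure Ω) (_ : IsProbabilityMeasure μ)
    (X : ℕ → Ω → Option T),
    IsTerminatingChain μ π Q X ∧
    HasLaw (fun ω => ((totalReward r₁ X ω : ℝ), (totalReward r₂ X ω : ℝ))) ν μ

/-- The class of bivariate MDPH* laws. -/
def MDPHStar : Set (Measure (ℝ × ℝ)) :=
  {ν | ∃ (T : Type) (_ : Fintype T) (π : T → ℝ) (Q : Matrix T T ℝ) (r₁ r₂ : T → ℕ),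
    IsMDPHStarLaw π Q r₁ r₂ ν}

end MDPHStar

/-! ### The chain `γ` -/

section Gamma

/-- The state space `E ∪ (S × S) ∪ ({∂₁} × S) ∪ (S × {∂₂})`; the one-point factor `Unit` stands for
`{∂₁}` in the third part and for `{∂₂}` in the fourth. -/
abbrev GammaState (E S : Type*) := (E ⊕ (S × S)) ⊕ ((Unit × S) ⊕ (S × Unit))

variable {E S : Type*}

/-- The initial vector `(α, 0, 0, 0)`. -/
def gammaInit (α : E → ℝ) : GammaState E S → ℝ := Sum.elim (Sum.elim α 0) 0

/-- The matrix `U*` with entries `u_{i j₁} δ_{j₁ j₂}`. -/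
def UStar [DecidableEq S] (U : Matrix E S ℝ) : Matrix E (S × S) ℝ :=
  Matrix.of fun i j => if j.1 = j.2 then U i j.1 else 0

/-- The block matrix
`P     U*        0         0`
`0   Q₁ ⊗ Q₂   q₁ ⊗ Q₂   Q₁ ⊗ q₂`
`0     0         Q₂        0`
`0     0         0         Q₁`. -/
def PMax [DecidableEq S] [Fintype S] (P : Matrix E E ℝ) (U : Matrix E S ℝ) (Q₁ Q₂ : Matrix S S ℝ) :
    Matrix (GammaState E S) (GammaState E S) ℝ :=
  Matrix.fromBlocks
    (Matrix.fromBlocks P (UStar U) 0 (Q₁ ⊗ₖ Q₂))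
    (Matrix.fromRows 0 (Matrix.fromCols
      (Matrix.replicateCol Unit (exitVec Q₁) ⊗ₖ Q₂) (Q₁ ⊗ₖ Matrix.replicateCol Unit (exitVec Q₂))))
    0
    (Matrix.fromBlocks ((1 : Matrix Unit Unit ℝ) ⊗ₖ Q₂) 0 0 (Q₁ ⊗ₖ (1 : Matrix Unit Unit ℝ)))

/-- The indicator of `E ∪ (S × S) ∪ (S × {∂₂})`. -/
def gammaReward₁ : GammaState E S → ℕ :=
  Sum.elim (fun _ => 1) (Sum.elim (fun _ => 0) (fun _ => 1))

/-- The indicator of `E ∪ (S × S) ∪ ({∂₁} × S)`. -/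
def gammaReward₂ : GammaState E S → ℕ :=
  Sum.elim (fun _ => 1) (Sum.elim (fun _ => 1) (fun _ => 0))

end Gamma

end PhaseType

/-! Both inclusions are couplings: the required process is built on the given probability space as a
function of the given one, and the variables to be compared agree almost surely.

For mDPH into CDPH, each chain is delayed by one unit of time spent in a single state. Decoupling
then always happens at time 1, so the common start becomes the agreement of `M₁` and `M₂` up to
decoupling, and each termination time grows by one, which the lattice `ℕ + 1` undoes.

For CDPH into MDPH*, `γ` is the pair `(M₁, M₂)` recorded as one state: the shared state inside `E`,
the pair of states afterwards. The algebraic core is `stepProb_PMax_enc_enc`: outside `E`, one step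
of `γ`, cemetery included, has the product of the two one-step probabilities. Together with the law
of `M₁` and the conditional law of `M₂` this gives the path probabilities of the pair
(`IsCommonShockPair.path_law`). They sum to one over the paths of `γ`, so almost surely the pair
never leaves the configurations that `γ` encodes. Finally `γ` terminates at `max τ₁ τ₂`, and the
`k`-th reward counts the instants at which the `k`-th coordinate is alive, so it totals `τₖ`. -/

namespace PhaseType

/-! ### Termination times and path probabilities of terminating chains -/

section General

variable {T Ω : Type*}

lemma terminationTime_eq {X : ℕ → Ω → Option T} {ω : Ω} {t : ℕ} (ht : 1 ≤ t)
    (h : ∀ n, X n ω = none ↔ t ≤ n) : terminationTime X ω = (t : WithTop ℕ) := by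
  refine le_antisymm (hittingAfter_le_of_mem ht ((h t).2 le_rfl)) ?_
  by_contra! hlt
  obtain ⟨s, hs⟩ := WithTop.ne_top_iff_exists.1 (hlt.trans_le le_top).ne
  have hmem := hittingAfter_mem_set_of_ne_top (u := X) (s := {none}) (n := 1) (ω := ω)
    (hlt.trans_le le_top).ne
  unfold terminationTime at hlt hs
  rw [← hs] at hmem hlt
  have h1 := (h s).1 hmem
  have h2 : s < t := (WithTop.coe_lt_coe (α := ℕ)).1 hlt
  omega

/-- The termination time ignores time 0 and records only the first visit to `none`. The hypothesis
on `X 0` covers the former, and absorption carries the visit to all later times. -/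
lemma eq_none_iff_of_absorbing {X : ℕ → Ω → Option T} {ω : Ω} (hlt : terminationTime X ω < ⊤)
    (h0 : X 0 ω ≠ none) (habs : ∀ n, X n ω = none → X (n + 1) ω = none) :
    ∃ t : ℕ, 1 ≤ t ∧ terminationTime X ω = (t : WithTop ℕ) ∧ ∀ n, X n ω = none ↔ t ≤ n := by
  obtain ⟨t, ht⟩ := WithTop.ne_top_iff_exists.1 hlt.ne
  have hmem := hittingAfter_mem_set_of_ne_top (u := X) (s := {none}) (n := 1) (ω := ω) hlt.ne
  have hle := le_hittingAfter (u := X) (s := {none}) (n := 1) ω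
  unfold terminationTime at ht
  rw [← ht] at hmem hle
  refine ⟨t, by exact_mod_cast hle, ht.symm, fun n => ⟨fun hn => ?_, fun hn => ?_⟩⟩
  · have hn0 : 1 ≤ n := by
      rcases Nat.eq_zero_or_pos n with rfl | h
      · exact absurd hn h0
      · exact h
    have h1 := hittingAfter_le_of_mem (u := X) (s := {none}) (n := 1) (ω := ω) hn0 hn
    rw [← ht] at h1
    exact_mod_cast h1
  · induction n, hn using Nat.le_induction with
    | base => exact hmem
    | succ k _ ih => exact habs k ih

lemma ae_exists_mem_of_sum_eq_one {ι : Type*} [Fintype ι] [MeasurableSpace Ω] {μ : Measure Ω}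
    [IsProbabilityMeasure μ]
    {A : ι → Set Ω} (hA : ∀ i, MeasurableSet (A i)) (hd : Pairwise (Function.onFun Disjoint A))
    {p : ι → ℝ} (hp : ∀ i, 0 ≤ p i) (hμ : ∀ i, μ (A i) = ENNReal.ofReal (p i))
    (hsum : ∑ i, p i = 1) : ∀ᵐ ω ∂μ, ∃ i, ω ∈ A i := by
  have h : μ (⋃ i, A i) = 1 := by
    rw [measure_iUnion hd hA, tsum_fintype]
    simp only [hμ]
    rw [← ENNReal.ofReal_sum_of_nonneg fun i _ => hp i, hsum, ENNReal.ofReal_one]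
  have h' := (mem_ae_iff_prob_eq_one (MeasurableSet.iUnion hA)).2 h
  filter_upwards [h'] with ω hω
  exact Set.mem_iUnion.1 hω

variable [Fintype T]

lemma exitVec_nonneg {Q : Matrix T T ℝ} (hQ : IsSubstochastic Q) (i : T) : 0 ≤ exitVec Q i :=
  sub_nonneg.2 (hQ.sum_le_one i)

lemma stepProb_nonneg {Q : Matrix T T ℝ} (hQ : IsSubstochastic Q) (a b : Option T) :
    0 ≤ stepProb Q a b := by
  rcases a with _ | a <;> rcases b with _ | b <;> simp only [stepProb, le_refl, zero_le_one]
  · exact exitVec_nonneg hQ a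
  · exact hQ.nonneg a b

lemma sum_stepProb (Q : Matrix T T ℝ) (a : Option T) : ∑ b, stepProb Q a b = 1 := by
  rcases a with _ | a <;> simp [Fintype.sum_option, stepProb, exitVec]

lemma initProb_nonneg {α : T → ℝ} (hα : α ∈ stdSimplex ℝ T) (a : Option T) :
    0 ≤ initProb α a := by
  rcases a with _ | a
  · exact le_rfl
  · exact hα.1 a

lemma sum_initProb {α : T → ℝ} (hα : α ∈ stdSimplex ℝ T) : ∑ a, initProb α a = 1 := by
  simp [Fintype.sum_option, initProb, hα.2]

lemma sum_prod_stepProb (Q : Matrix T T ℝ) (n : ℕ) (a : Option T) :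
    ∑ x : Fin n → Option T, ∏ k : Fin n, stepProb Q
      ((Fin.cons a x : Fin (n + 1) → Option T) k.castSucc)
      ((Fin.cons a x : Fin (n + 1) → Option T) k.succ) = 1 := by
  induction n generalizing a with
  | zero => simp
  | succ n ih =>
    rw [← (Fin.consEquiv (fun _ : Fin (n + 1) => Option T)).sum_comp, Fintype.sum_prod_type]
    simp only [Fin.prod_univ_succ, Fin.consEquiv_apply, Fin.cons_succ, Fin.castSucc_zero,
      Fin.cons_zero, ← Finset.mul_sum, ← Fin.succ_castSucc]
    simp only [Fin.cons_succ] at ih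
    simp only [ih, mul_one, sum_stepProb]

lemma sum_path_prob {α : T → ℝ} (hα : α ∈ stdSimplex ℝ T) (Q : Matrix T T ℝ) (n : ℕ) :
    ∑ x : Fin (n + 1) → Option T,
      initProb α (x 0) * ∏ k : Fin n, stepProb Q (x k.castSucc) (x k.succ) = 1 := by
  rw [← (Fin.consEquiv (fun _ : Fin (n + 1) => Option T)).sum_comp, Fintype.sum_prod_type]
  simp only [Fin.consEquiv_apply, Fin.cons_zero, ← Finset.mul_sum, sum_prod_stepProb, mul_one,
    sum_initProb hα]

variable [MeasurableSpace Ω] {μ : Measure Ω}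

/-- If the finite-dimensional laws of a process charge the paths in the image of `d` with the path
probabilities of a terminating chain, then the process stays in the image of `d`. -/
lemma ae_mem_range_of_path_law {V : Type*} [IsProbabilityMeasure μ] {Y : ℕ → Ω → V}
    {d : Option T → V} (hd : Function.Injective d) (hY : ∀ n v, MeasurableSet {ω | Y n ω = v})
    {α : T → ℝ} (hα : α ∈ stdSimplex ℝ T) {Q : Matrix T T ℝ} (hQ : IsSubstochastic Q)
    (hlaw : ∀ (n : ℕ) (x : ℕ → Option T), μ {ω | ∀ k ≤ n, Y k ω = d (x k)} =
      ENNReal.ofReal (initProb α (x 0) * ∏ k ∈ Finset.range n, stepProb Q (x k) (x (k + 1)))) :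
    ∀ᵐ ω ∂μ, ∀ n, ∃ g, Y n ω = d g := by
  rw [ae_all_iff]
  intro n
  have key := ae_exists_mem_of_sum_eq_one (μ := μ)
    -- A finite path is extended to all times by reducing the index modulo `n + 1`; only the times
    -- `k ≤ n`, where this changes nothing, are used.
    (A := fun x : Fin (n + 1) → Option T => {ω | ∀ k ≤ n, Y k ω = d (x (Fin.ofNat (n + 1) k))})
    (p := fun x => initProb α (x 0) * ∏ k : Fin n, stepProb Q (x k.castSucc) (x k.succ))
    (fun x => ?_) (fun x y hxy => ?_) (fun x => ?_) (fun x => ?_) (sum_path_prob hα Q n)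
  · filter_upwards [key] with ω ⟨x, hx⟩
    exact ⟨_, hx n le_rfl⟩
  · have : {ω | ∀ k ≤ n, Y k ω = d (x (Fin.ofNat (n + 1) k))} =
        ⋂ k ∈ Set.Iic n, {ω | Y k ω = d (x (Fin.ofNat (n + 1) k))} := by
      ext ω; simp
    rw [this]
    exact MeasurableSet.biInter (Set.to_countable _) fun k _ => hY k _
  · refine Set.disjoint_left.2 fun ω hx hy => hxy (funext fun k => ?_)
    have h1 := hd ((hx k (Nat.lt_succ_iff.1 k.2)).symm.trans (hy k (Nat.lt_succ_iff.1 k.2)))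
    simpa using h1
  · exact mul_nonneg (initProb_nonneg hα _) (Finset.prod_nonneg fun k _ => stepProb_nonneg hQ _ _)
  · rw [hlaw n fun k => x (Fin.ofNat (n + 1) k), Finset.prod_range]
    congr 2
    refine Finset.prod_congr rfl fun k _ => ?_
    congr 2 <;> ext <;> simp [Nat.mod_eq_of_lt]

variable {α : T → ℝ} {Q : Matrix T T ℝ} {X : ℕ → Ω → Option T}

/-- For fixed `n` there are only finitely many paths, so the null ones can be discarded together.
The structure of a chain prescribes path probabilities only; pathwise facts such as absorption in
`none` are extracted from here. -/
lemma ae_path_prob_ne_zero (hlaw : ∀ (n : ℕ) (x : ℕ → Option T),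
      μ {ω | ∀ k ≤ n, X k ω = x k} = ENNReal.ofReal (initProb α (x 0) *
        ∏ k ∈ Finset.range n, stepProb Q (x k) (x (k + 1)))) :
    ∀ᵐ ω ∂μ, ∀ n, initProb α (X 0 ω) *
      ∏ k ∈ Finset.range n, stepProb Q (X k ω) (X (k + 1) ω) ≠ 0 := by
  rw [ae_all_iff]
  intro n
  have key : ∀ x : Fin (n + 1) → Option T, ∀ᵐ ω ∂μ,
      initProb α (x 0) * ∏ k ∈ Finset.range n,
        stepProb Q (x (Fin.ofNat (n + 1) k)) (x (Fin.ofNat (n + 1) (k + 1))) = 0 →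
      ¬ ∀ k ≤ n, X k ω = x (Fin.ofNat (n + 1) k) := by
    intro x
    by_cases hx : initProb α (x 0) * ∏ k ∈ Finset.range n,
        stepProb Q (x (Fin.ofNat (n + 1) k)) (x (Fin.ofNat (n + 1) (k + 1))) = 0
    · have h1 := hlaw n fun k => x (Fin.ofNat (n + 1) k)
      have h2 : initProb α (x (Fin.ofNat (n + 1) 0)) * ∏ k ∈ Finset.range n,
        stepProb Q (x (Fin.ofNat (n + 1) k)) (x (Fin.ofNat (n + 1) (k + 1))) = 0 := hx
      rw [h2, ENNReal.ofReal_zero] at h1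
      simp only [hx, forall_const]
      rw [ae_iff]
      simpa only [not_not] using h1
    · exact Filter.Eventually.of_forall fun _ h0 => absurd h0 hx
  filter_upwards [ae_all_iff.2 key] with ω hω h0
  have hval : ∀ k ≤ n, ((Fin.ofNat (n + 1) k : Fin (n + 1)) : ℕ) = k := fun k hk => by
    simp only [Fin.val_ofNat]
    exact Nat.mod_eq_of_lt (Nat.lt_succ_of_le hk)
  refine hω (fun k => X k ω) ?_ fun k hk => by simp only [hval k hk]
  rw [← h0]
  congr 1
  refine Finset.prod_congr rfl fun k hk => ?_
  have := Finset.mem_range.1 hk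
  simp only [hval k (by omega), hval (k + 1) (by omega)]

lemma ae_initProb_ne_zero (hlaw : ∀ (n : ℕ) (x : ℕ → Option T),
      μ {ω | ∀ k ≤ n, X k ω = x k} = ENNReal.ofReal (initProb α (x 0) *
        ∏ k ∈ Finset.range n, stepProb Q (x k) (x (k + 1)))) :
    ∀ᵐ ω ∂μ, initProb α (X 0 ω) ≠ 0 := by
  filter_upwards [ae_path_prob_ne_zero hlaw] with ω hω
  exact left_ne_zero_of_mul (hω 0)

lemma ae_stepProb_ne_zero (hlaw : ∀ (n : ℕ) (x : ℕ → Option T),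
      μ {ω | ∀ k ≤ n, X k ω = x k} = ENNReal.ofReal (initProb α (x 0) *
        ∏ k ∈ Finset.range n, stepProb Q (x k) (x (k + 1)))) :
    ∀ᵐ ω ∂μ, ∀ n, stepProb Q (X n ω) (X (n + 1) ω) ≠ 0 := by
  filter_upwards [ae_path_prob_ne_zero hlaw] with ω hω n
  exact Finset.prod_ne_zero_iff.1 (right_ne_zero_of_mul (hω (n + 1))) n (by simp)

lemma IsTerminatingChain.ae_eq_none_iff (h : IsTerminatingChain μ α Q X) :
    ∀ᵐ ω ∂μ, ∃ t : ℕ, 1 ≤ t ∧ terminationTime X ω = (t : WithTop ℕ) ∧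
      ∀ n, X n ω = none ↔ t ≤ n := by
  filter_upwards [h.terminates, ae_initProb_ne_zero h.law,
    ae_stepProb_ne_zero h.law] with ω h1 h2 h3
  refine eq_none_iff_of_absorbing h1 (fun h0 => h2 (by rw [h0]; rfl)) fun n hn => ?_
  by_contra hne
  obtain ⟨j, hj⟩ := Option.ne_none_iff_exists'.1 hne
  exact h3 n (by rw [hn, hj]; rfl)

end General

lemma untopD_cast_nat (d t : ℕ) : ((t : ℕ) : WithTop ℕ).untopD d = t := rfl

/-! ### Decoupling times and the block matrix of the first chain -/

section CommonShock

variable {E S Ω : Type*}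

lemma measurableSet_of_fibers {V : Type*} [Countable V] [MeasurableSpace Ω] {Y : Ω → V}
    (hY : ∀ v, MeasurableSet {ω | Y ω = v}) (p : V → Prop) : MeasurableSet {ω | p (Y ω)} := by
  have : {ω | p (Y ω)} = ⋃ v ∈ {v | p v}, {ω | Y ω = v} := by
    ext ω; simp
  rw [this]
  exact MeasurableSet.biUnion (Set.to_countable _) fun v _ => hY v

lemma le_decouplingTime {M : ℕ → Ω → Option (E ⊕ S)} {ω : Ω} {m : ℕ}
    (h : ∀ k < m, ∃ i : E, M k ω = some (Sum.inl i)) :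
    (m : WithTop ℕ) ≤ decouplingTime M ω := by
  by_contra! hlt
  obtain ⟨s, hs⟩ := WithTop.ne_top_iff_exists.1 (hlt.trans_le le_top).ne
  have hmem := hittingAfter_mem_set_of_ne_top (u := M)
    (s := {x | ∀ i : E, x ≠ some (Sum.inl i)}) (n := 1) (ω := ω) (hlt.trans_le le_top).ne
  unfold decouplingTime at hlt hs
  rw [← hs] at hmem hlt
  obtain ⟨i, hi⟩ := h s ((WithTop.coe_lt_coe (α := ℕ)).1 hlt)
  exact hmem i hi

lemma decouplingTime_eq {M : ℕ → Ω → Option (E ⊕ S)} {ω : Ω} {m : ℕ} (hm : 1 ≤ m)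
    (hlt : ∀ k < m, ∃ i : E, M k ω = some (Sum.inl i))
    (hout : ∀ i : E, M m ω ≠ some (Sum.inl i)) : decouplingTime M ω = (m : WithTop ℕ) :=
  le_antisymm (hittingAfter_le_of_mem hm hout) (le_decouplingTime hlt)

variable [Fintype E] [Fintype S] (P : Matrix E E ℝ) (U : Matrix E S ℝ) (Q : Matrix S S ℝ)

lemma stepProb_fromBlocks_inr (a b : Option S) :
    stepProb (fromBlocks P U 0 Q) (a.map Sum.inr) (b.map Sum.inr) = stepProb Q a b := by
  rcases a with _ | a <;> rcases b with _ | b <;> simp [stepProb, exitVec]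

lemma stepProb_fromBlocks_inr_inl (a : Option S) (i : E) :
    stepProb (fromBlocks P U 0 Q) (a.map Sum.inr) (some (Sum.inl i)) = 0 := by
  rcases a with _ | a <;> simp [stepProb]

end CommonShock

/-! ### From mDPH to CDPH: delaying both chains by one step -/

section OneStepDelay

variable {S Ω : Type*}

/-- The process on `Unit ⊕ S` that spends one time unit in the state `inl ()` and then follows
`X`. -/
def delay (X : ℕ → Ω → Option S) : ℕ → Ω → Option (Unit ⊕ S)
  | 0, _ => some (Sum.inl ())
  | n + 1, ω => (X n ω).map Sum.inr

lemma decouplingTime_delay (X : ℕ → Ω → Option S) (ω : Ω) :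
    decouplingTime (delay X) ω = ((1 : ℕ) : WithTop ℕ) := by
  refine decouplingTime_eq le_rfl (fun k hk => ⟨(), ?_⟩) fun i => ?_
  · obtain rfl : k = 0 := by omega
    rfl
  · cases h : X 0 ω <;> simp [delay, h]

lemma terminationTime_delay {X : ℕ → Ω → Option S} {ω : Ω} {t : ℕ}
    (h : ∀ n, X n ω = none ↔ t ≤ n) : terminationTime (delay X) ω = ((t + 1 : ℕ) : WithTop ℕ) := by
  refine terminationTime_eq (by omega) fun n => ?_
  rcases n with _ | n
  · simp [delay]
  · simp [delay, h]

variable [Fintype S] [MeasurableSpace Ω] {μ : Measure Ω} {β : S → ℝ} {Q Q₁ Q₂ : Matrix S S ℝ}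
  {X X₁ X₂ : ℕ → Ω → Option S}

lemma measurableSet_delay_eq (hX : ∀ n x, MeasurableSet {ω | X n ω = x}) (n : ℕ)
    (x : Option (Unit ⊕ S)) : MeasurableSet {ω | delay X n ω = x} := by
  rcases n with _ | n
  · exact MeasurableSet.const (some (Sum.inl ()) = x)
  · exact measurableSet_of_fibers (hX n) fun a => a.map Sum.inr = x

/-- The first step of the delayed chain plays the part of the initial draw. The value at `none` is
zero on both sides because `β` sums to one. -/
lemma stepProb_enter (hβ : β ∈ stdSimplex ℝ S) (a : Option S) :
    stepProb (fromBlocks (0 : Matrix Unit Unit ℝ) (replicateRow Unit β) 0 Q) (some (Sum.inl ()))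
      (a.map Sum.inr) = initProb β a := by
  rcases a with _ | a <;> simp [stepProb, exitVec, initProb, hβ.2]

/-- A path that starts elsewhere than in the extra state, or revisits it, is never taken and has a
vanishing factor: the column of the extra state is zero. For all other paths the factor of step 0 is
the initial probability of `X`. -/
lemma IsTerminatingChain.delay [IsProbabilityMeasure μ] (hβ : β ∈ stdSimplex ℝ S)
    (h : IsTerminatingChain μ β Q X) :
    IsTerminatingChain μ (Sum.elim (fun _ : Unit => 1) 0)
      (fromBlocks 0 (replicateRow Unit β) 0 Q) (delay X) where
  measurable := measurableSet_delay_eq h.measurable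
  law n x := by
    by_cases hx0 : x 0 = some (Sum.inl ())
    · have hinit : initProb (Sum.elim (fun _ : Unit => (1 : ℝ)) (0 : S → ℝ)) (x 0) = 1 := by
        rw [hx0]; rfl
      rw [hinit, one_mul]
      rcases n with _ | n
      · simp [PhaseType.delay, hx0]
      · by_cases hx : ∀ k ≤ n, ∃ a : Option S, x (k + 1) = a.map Sum.inr
        · choose! a ha using hx
          have hset : {ω | ∀ k ≤ n + 1, PhaseType.delay X k ω = x k} =
              {ω | ∀ k ≤ n, X k ω = a k} := by
            ext ω
            have hinj := Option.map_injective (Sum.inr_injective (α := Unit) (β := S))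
            refine ⟨fun hω k hk => hinj ?_, fun hω k hk => ?_⟩
            · rw [← ha k hk]
              exact hω (k + 1) (by omega)
            · rcases k with _ | k
              · exact hx0.symm
              · rw [ha k (by omega), ← hω k (by omega)]
                rfl
          rw [hset, h.law, Finset.prod_range_succ', hx0, ha 0 (by omega), stepProb_enter hβ, mul_comm]
          congr 2
          refine Finset.prod_congr rfl fun k hk => ?_
          have := Finset.mem_range.1 hk
          rw [ha k (by omega), ha (k + 1) (by omega), stepProb_fromBlocks_inr]
        · push Not at hx
          obtain ⟨k, hk, hka⟩ := hx
          have hset : {ω | ∀ k ≤ n + 1, PhaseType.delay X k ω = x k} = ∅ := by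
            ext ω
            simp only [Set.mem_ofPred_eq, Set.mem_empty_iff_false, iff_false]
            exact fun hω => hka (X k ω) (hω (k + 1) (by omega)).symm
          have hxk : x (k + 1) = some (Sum.inl ()) := by
            rcases hc : x (k + 1) with _ | ⟨_ | j⟩
            · exact absurd hc (hka none)
            · rfl
            · exact absurd hc (hka (some j))
          rw [hset, measure_empty, Finset.prod_eq_zero (i := k) (by simp; omega),
            ENNReal.ofReal_zero]
          rw [hxk]
          rcases x k with _ | ⟨_ | j⟩ <;> simp [stepProb]
    · have hset : {ω | ∀ k ≤ n, PhaseType.delay X k ω = x k} = ∅ := by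
        ext ω
        simp only [Set.mem_ofPred_eq, Set.mem_empty_iff_false, iff_false]
        exact fun hω => hx0 (hω 0 (by omega)).symm
      have hinit : initProb (Sum.elim (fun _ : Unit => (1 : ℝ)) (0 : S → ℝ)) (x 0) = 0 := by
        rcases hc : x 0 with _ | ⟨_ | j⟩
        · rfl
        · exact absurd hc hx0
        · rfl
      rw [hset, hinit, zero_mul, measure_empty, ENNReal.ofReal_zero]
  terminates := by
    filter_upwards [h.ae_eq_none_iff] with ω ⟨t, _, _, ht⟩
    rw [terminationTime_delay ht]
    exact WithTop.coe_lt_top _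

/-- The joint law is prescribed only for paths with a common start, but these starts already carry
the total mass of `β`, which is one. -/
lemma IsSameStartPair.ae_start_eq [IsProbabilityMeasure μ] (hβ : β ∈ stdSimplex ℝ S)
    (h : IsSameStartPair μ β Q₁ Q₂ X₁ X₂) : ∀ᵐ ω ∂μ, X₂ 0 ω = X₁ 0 ω := by
  have key := ae_exists_mem_of_sum_eq_one (μ := μ)
    (A := fun i : S => {ω | X₁ 0 ω = some i} ∩ {ω | X₂ 0 ω = some i}) (p := β)
    (fun i => (h.chain₁.measurable 0 _).inter (h.chain₂.measurable 0 _))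
    (fun i j hij => Set.disjoint_left.2 fun ω hi hj =>
      hij (Option.some_injective _ (hi.1.symm.trans hj.1)))
    hβ.1 (fun i => ?_) hβ.2
  · filter_upwards [key] with ω ⟨i, h1, h2⟩
    exact h2.trans h1.symm
  · have := h.law 0 0 i (fun _ => some i) (fun _ => some i) rfl rfl
    simpa [Set.ofPred_and] using this

lemma IsSameStartPair.isCommonShockPair_delay [IsProbabilityMeasure μ]
    (hβ : β ∈ stdSimplex ℝ S) (hQ₁ : IsSubstochastic Q₁)
    (h : IsSameStartPair μ β Q₁ Q₂ X₁ X₂) :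
    IsCommonShockPair μ (fun _ : Unit => 1) 0 (replicateRow Unit β) Q₁ Q₂ (delay X₁)
      (delay X₂) where
  chain₁ := h.chain₁.delay hβ
  measurable₂ := measurableSet_delay_eq h.chain₂.measurable
  agree := by
    filter_upwards [h.ae_start_eq hβ] with ω hω n hn
    rw [decouplingTime_delay] at hn
    have hn1 : n ≤ 1 := by exact_mod_cast hn
    interval_cases n
    · rfl
    · simp only [delay, hω]
  independent m N n j y z hz := by
    have hinj := Option.map_injective (Sum.inr_injective (α := Unit) (β := S))
    -- If the conditioning event is non-empty, the path of one of its points `ω₀` can replace `y`,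
    -- which makes the event a cylinder event of `X₁`.
    rcases Set.eq_empty_or_nonempty {ω | decouplingTime (delay X₁) ω = (m : WithTop ℕ) ∧
      delay X₁ m ω = some (Sum.inr j) ∧ ∀ k ≤ N, delay X₁ k ω = y k} with hemp | ⟨ω₀, hm, hj, hy⟩
    · rw [hemp, measure_empty, zero_mul, Set.ofPred_and, hemp, Set.empty_inter, measure_empty]
    · rw [decouplingTime_delay] at hm
      obtain rfl : 1 = m := by exact_mod_cast hm
      have hj0 : X₁ 0 ω₀ = some j := hinj hj
      -- The delayed path up to `N` sees `X₁` up to `N - 1`. For `N = 0` the truncation is harmless,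
      -- since the state at time 1 already fixes `X₁ 0`.
      have hiff : ∀ ω, (decouplingTime (delay X₁) ω = ((1 : ℕ) : WithTop ℕ) ∧
          delay X₁ 1 ω = some (Sum.inr j) ∧ ∀ k ≤ N, delay X₁ k ω = y k) ↔
          ∀ k ≤ N - 1, X₁ k ω = X₁ k ω₀ := by
        intro ω
        refine ⟨fun ⟨_, h1, h2⟩ k hk => ?_, fun hω => ⟨decouplingTime_delay _ _, ?_, ?_⟩⟩
        · rcases k with _ | k
          · exact (hinj h1 : X₁ 0 ω = some j).trans hj0.symm
          · exact hinj ((h2 (k + 2) (by omega)).trans (hy (k + 2) (by omega)).symm)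
        · rw [← hj]
          simp only [delay, hω 0 (by omega)]
        · intro k hk
          rw [← hy k hk]
          rcases k with _ | k
          · rfl
          · simp only [delay, hω k (by omega)]
      have hiff₂ : ∀ ω, (∀ k ≤ n, delay X₂ (1 + k) ω = (z k).map Sum.inr) ↔
          ∀ k ≤ n, X₂ k ω = z k := fun ω => by
        refine forall₂_congr fun k _ => ?_
        rw [add_comm 1 k]
        exact hinj.eq_iff
      simp only [hiff, hiff₂]
      rw [h.law (N - 1) n j (fun k => X₁ k ω₀) z hj0 hz, h.chain₁.law (N - 1) fun k => X₁ k ω₀,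
        ENNReal.ofReal_mul]
      · simp only [hj0, initProb]
      · exact mul_nonneg (hβ.1 j) (Finset.prod_nonneg fun k _ => stepProb_nonneg hQ₁ _ _)
  terminates₂ := (h.chain₂.delay hβ).terminates

lemma IsMDPHLaw.isCDPHLaw {ν : Measure (ℝ × ℝ)} (h : IsMDPHLaw β Q₁ Q₂ ν) :
    IsCDPHLaw 1 1 1 1 (fun _ : Unit => 1) (0 : Matrix Unit Unit ℝ) (replicateRow Unit β)
      Q₁ Q₂ ν := by
  obtain ⟨hβ, hQ₁, hQ₂, Ω, _, μ, _, X₁, X₂, hX, hlaw⟩ := h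
  refine ⟨⟨⟨fun _ => zero_le_one, by simp⟩, fun _ _ => le_rfl, fun _ j => hβ.1 j,
    fun _ => by simp [hβ.2], hQ₁, hQ₂⟩, Ω, _, μ, inferInstance, delay X₁, delay X₂,
    hX.isCommonShockPair_delay hβ hQ₁, hlaw.congr ?_⟩
  filter_upwards [hX.chain₁.ae_eq_none_iff, hX.chain₂.ae_eq_none_iff]
    with ω ⟨t₁, _, h₁, h₁'⟩ ⟨t₂, _, h₂, h₂'⟩
  rw [terminationTime_delay h₁', terminationTime_delay h₂', h₁, h₂]
  simp only [untopD_cast_nat]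
  simp only [Nat.cast_add, Nat.cast_one, one_mul]
  -- The delay and the lattice shift cancel: `(t + 1) - 2 + 1 = t`.
  congr 1 <;> ring

lemma MDPH_subset_CDPH : MDPH ⊆ CDPH 1 1 1 1 := by
  rintro ν ⟨S, _, β, Q₁, Q₂, h⟩
  have hS : Nonempty S := by
    by_contra hS
    rw [not_nonempty_iff] at hS
    simpa using h.1.2
  exact ⟨Unit, S, inferInstance, inferInstance, inferInstance, hS, _, _, _, _, _, h.isCDPHLaw⟩

end OneStepDelay

/-! ### Encoding pairs of states by `γ`, and the matrix `PMax` -/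

section GammaCoordinates

variable {E S : Type*}

/-- The state of `γ` that encodes a pair of states of the decoupled chains; `none` stands for a
chain that has terminated. -/
def gammaEnc : Option S → Option S → Option (GammaState E S)
  | some a, some b => some (Sum.inl (Sum.inr (a, b)))
  | none, some b => some (Sum.inr (Sum.inl ((), b)))
  | some a, none => some (Sum.inr (Sum.inr (a, ())))
  | none, none => none

/-- The state of the first chain read off from the state of `γ`. -/
def gammaCoord₁ : Option (GammaState E S) → Option (E ⊕ S)
  | none => none
  | some (Sum.inl (Sum.inl i)) => some (Sum.inl i)
  | some (Sum.inl (Sum.inr (a, _))) => some (Sum.inr a)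
  | some (Sum.inr (Sum.inl _)) => none
  | some (Sum.inr (Sum.inr (a, _))) => some (Sum.inr a)

/-- The state of the second chain read off from the state of `γ`. -/
def gammaCoord₂ : Option (GammaState E S) → Option (E ⊕ S)
  | none => none
  | some (Sum.inl (Sum.inl i)) => some (Sum.inl i)
  | some (Sum.inl (Sum.inr (_, b))) => some (Sum.inr b)
  | some (Sum.inr (Sum.inl (_, b))) => some (Sum.inr b)
  | some (Sum.inr (Sum.inr _)) => none

/-- The state of `γ` that belongs to a pair of states of the two chains. -/
def gammaMerge (u v : Option (E ⊕ S)) : Option (GammaState E S) :=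
  match u with
  | some (Sum.inl i) => some (Sum.inl (Sum.inl i))
  | u => gammaEnc (u.bind Sum.getRight?) (v.bind Sum.getRight?)

lemma gammaCoord₁_enc (a b : Option S) :
    gammaCoord₁ (gammaEnc a b : Option (GammaState E S)) = a.map Sum.inr := by
  rcases a with _ | a <;> rcases b with _ | b <;> rfl

lemma gammaCoord₂_enc (a b : Option S) :
    gammaCoord₂ (gammaEnc a b : Option (GammaState E S)) = b.map Sum.inr := by
  rcases a with _ | a <;> rcases b with _ | b <;> rfl

lemma exists_eq_inl_or_gammaEnc (g : Option (GammaState E S)) :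
    (∃ i, g = some (Sum.inl (Sum.inl i))) ∨ ∃ a b, g = gammaEnc a b := by
  rcases g with _ | ((i | ⟨a, b⟩) | (⟨_, b⟩ | ⟨a, _⟩))
  · exact Or.inr ⟨none, none, rfl⟩
  · exact Or.inl ⟨i, rfl⟩
  · exact Or.inr ⟨some a, some b, rfl⟩
  · exact Or.inr ⟨none, some b, rfl⟩
  · exact Or.inr ⟨some a, none, rfl⟩

/-- The inverse is one-sided: a pair such as `(some (inl i), none)` does not consist of coordinates
of any state of `γ`, and `gammaMerge` gives it a junk value. `IsCommonShockPair.ae_eq_gammaCoord`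
shows that such pairs almost surely do not occur. -/
lemma gammaMerge_coord (g : Option (GammaState E S)) :
    gammaMerge (gammaCoord₁ g) (gammaCoord₂ g) = g := by
  rcases g with _ | ((i | ⟨a, b⟩) | (⟨_, b⟩ | ⟨a, _⟩)) <;> rfl

lemma gammaCoord_injective :
    Function.Injective fun g : Option (GammaState E S) => (gammaCoord₁ g, gammaCoord₂ g) := by
  intro g g' h
  rw [← gammaMerge_coord g, ← gammaMerge_coord g', (Prod.mk.inj h).1, (Prod.mk.inj h).2]

lemma gammaCoord_eq_none_iff (g : Option (GammaState E S)) :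
    g = none ↔ gammaCoord₁ g = none ∧ gammaCoord₂ g = none := by
  rcases g with _ | ((i | ⟨a, b⟩) | (⟨_, b⟩ | ⟨a, _⟩)) <;> simp [gammaCoord₁, gammaCoord₂]

open Classical in
lemma elim_gammaReward₁ (g : Option (GammaState E S)) :
    g.elim 0 gammaReward₁ = if gammaCoord₁ g = none then 0 else 1 := by
  rcases g with _ | ((i | ⟨a, b⟩) | (⟨_, b⟩ | ⟨a, _⟩)) <;> simp [gammaCoord₁, gammaReward₁]

open Classical in
lemma elim_gammaReward₂ (g : Option (GammaState E S)) :
    g.elim 0 gammaReward₂ = if gammaCoord₂ g = none then 0 else 1 := by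
  rcases g with _ | ((i | ⟨a, b⟩) | (⟨_, b⟩ | ⟨a, _⟩)) <;> simp [gammaCoord₂, gammaReward₂]

lemma initProb_gammaInit_enc (α : E → ℝ) (a b : Option S) :
    initProb (gammaInit α : GammaState E S → ℝ) (gammaEnc a b) = 0 := by
  rcases a with _ | a <;> rcases b with _ | b <;> rfl

lemma initProb_elim_inr (α : E → ℝ) (a : Option S) :
    initProb (Sum.elim α (0 : S → ℝ)) (a.map Sum.inr) = 0 := by
  rcases a with _ | a <;> rfl

variable [Fintype E] [Fintype S]

lemma gammaInit_mem_stdSimplex {α : E → ℝ} (hα : α ∈ stdSimplex ℝ E) :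
    (gammaInit α : GammaState E S → ℝ) ∈ stdSimplex ℝ (GammaState E S) := by
  refine ⟨?_, ?_⟩
  · rintro ((i | i) | i)
    · exact hα.1 i
    · exact le_rfl
    · exact le_rfl
  · simp [gammaInit, Fintype.sum_sum_type, hα.2]

lemma IsCDPHParam.exitVec_inl {α : E → ℝ} {P : Matrix E E ℝ} {U : Matrix E S ℝ}
    {Q₁ Q₂ : Matrix S S ℝ} (h : IsCDPHParam α P U Q₁ Q₂) (Q : Matrix S S ℝ) (i : E) :
    exitVec (fromBlocks P U 0 Q) (Sum.inl i) = 0 := by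
  simp [exitVec, Fintype.sum_sum_type, h.sum_row i]

lemma IsCDPHParam.isSubstochastic_fromBlocks {α : E → ℝ} {P : Matrix E E ℝ} {U : Matrix E S ℝ}
    {Q₁ Q₂ : Matrix S S ℝ} (h : IsCDPHParam α P U Q₁ Q₂) :
    IsSubstochastic (fromBlocks P U 0 Q₁) where
  nonneg := by
    rintro (i | i) (j | j)
    · exact h.nonneg_P i j
    · exact h.nonneg_U i j
    · exact le_rfl
    · exact h.sub₁.nonneg i j
  sum_le_one := by
    rintro (i | i)
    · simp [Fintype.sum_sum_type, h.sum_row i]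
    · simpa [Fintype.sum_sum_type] using h.sub₁.sum_le_one i

variable [DecidableEq S] (P : Matrix E E ℝ) (U : Matrix E S ℝ) (Q₁ Q₂ : Matrix S S ℝ)

lemma stepProb_PMax_inl_diag (i : E) (j : S) :
    stepProb (PMax P U Q₁ Q₂) (some (Sum.inl (Sum.inl i))) (gammaEnc (some j) (some j)) =
      U i j := by
  simp [stepProb, gammaEnc, PMax, UStar]

lemma stepProb_PMax_inl_of_ne (i : E) {a b : Option S} (hab : a ≠ b) :
    stepProb (PMax P U Q₁ Q₂) (some (Sum.inl (Sum.inl i))) (gammaEnc a b) = 0 := by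
  rcases a with _ | a <;> rcases b with _ | b
  · exact absurd rfl hab
  · simp [stepProb, gammaEnc, PMax]
  · simp [stepProb, gammaEnc, PMax]
  · have : a ≠ b := fun h => hab (by rw [h])
    simp [stepProb, gammaEnc, PMax, UStar, this]

lemma stepProb_PMax_inl_none (i : E) :
    stepProb (PMax P U Q₁ Q₂) (some (Sum.inl (Sum.inl i))) none =
      1 - (∑ j, P i j + ∑ j, U i j) := by
  simp [stepProb, exitVec, PMax, UStar, Fintype.sum_sum_type, Fintype.sum_prod_type]

lemma stepProb_PMax_enc_inl (a b : Option S) (i : E) :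
    stepProb (PMax P U Q₁ Q₂) (gammaEnc a b) (some (Sum.inl (Sum.inl i))) = 0 := by
  rcases a with _ | a <;> rcases b with _ | b <;> simp [stepProb, gammaEnc, PMax]

/-- The blocks of `PMax` below `E` are the tensor product of the two matrices completed by their
cemeteries. The entry for simultaneous termination is a complement: with row sums `s₁`, `s₂` and `qₖ
= 1 - sₖ`, one has `1 - s₁s₂ - q₁s₂ - s₁q₂ = q₁q₂`. -/
lemma stepProb_PMax_enc_enc (a b a' b' : Option S) :
    stepProb (PMax P U Q₁ Q₂) (gammaEnc a b) (gammaEnc a' b') =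
      stepProb Q₁ a a' * stepProb Q₂ b b' := by
  rcases a with _ | a <;> rcases b with _ | b <;> rcases a' with _ | a' <;> rcases b' with _ | b' <;>
    simp [stepProb, gammaEnc, PMax, exitVec, Fintype.sum_sum_type, Fintype.sum_prod_type,
      ← Finset.mul_sum, ← Finset.sum_mul]
  ring

/-- Nonnegativity includes the step into the cemetery, which is the row sum bound for `PMax`; the
product form makes summing the blocks unnecessary. -/
lemma IsCDPHParam.stepProb_PMax_nonneg {α : E → ℝ} {P : Matrix E E ℝ} {U : Matrix E S ℝ}
    {Q₁ Q₂ : Matrix S S ℝ} (h : IsCDPHParam α P U Q₁ Q₂) (g g' : Option (GammaState E S)) :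
    0 ≤ stepProb (PMax P U Q₁ Q₂) g g' := by
  rcases exists_eq_inl_or_gammaEnc g with ⟨i, rfl⟩ | ⟨a, b, rfl⟩ <;>
    rcases exists_eq_inl_or_gammaEnc g' with ⟨i', rfl⟩ | ⟨a', b', rfl⟩
  · exact h.nonneg_P i i'
  · by_cases hab : a' = b'
    · subst hab
      rcases a' with _ | j
      · refine (stepProb_PMax_inl_none P U Q₁ Q₂ i).symm ▸ ?_
        rw [h.sum_row i, sub_self]
      · rw [stepProb_PMax_inl_diag]
        exact h.nonneg_U i j
    · rw [stepProb_PMax_inl_of_ne _ _ _ _ _ hab]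
  · rw [stepProb_PMax_enc_inl]
  · rw [stepProb_PMax_enc_enc]
    exact mul_nonneg (stepProb_nonneg h.sub₁ _ _) (stepProb_nonneg h.sub₂ _ _)

lemma IsCDPHParam.isSubstochastic_PMax {α : E → ℝ} {P : Matrix E E ℝ} {U : Matrix E S ℝ}
    {Q₁ Q₂ : Matrix S S ℝ} (h : IsCDPHParam α P U Q₁ Q₂) :
    IsSubstochastic (PMax P U Q₁ Q₂) where
  nonneg g g' := h.stepProb_PMax_nonneg (some g) (some g')
  sum_le_one g := sub_nonneg.1 (h.stepProb_PMax_nonneg (some g) none)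

lemma gammaCoord₂_eq_none_of_stepProb_ne_zero {g g' : Option (GammaState E S)}
    (hg : gammaCoord₂ g = none) (h : stepProb (PMax P U Q₁ Q₂) g g' ≠ 0) :
    gammaCoord₂ g' = none := by
  rcases exists_eq_inl_or_gammaEnc g with ⟨i, rfl⟩ | ⟨a, b, rfl⟩
  · simp [gammaCoord₂] at hg
  · rcases exists_eq_inl_or_gammaEnc g' with ⟨i', rfl⟩ | ⟨a', b', rfl⟩
    · exact absurd (stepProb_PMax_enc_inl _ _ _ _ _ _ _) h
    · rw [stepProb_PMax_enc_enc] at h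
      rw [gammaCoord₂_enc, Option.map_eq_none_iff] at hg ⊢
      subst hg
      rcases b' with _ | b'
      · rfl
      · exact absurd rfl (right_ne_zero_of_mul h)

end GammaCoordinates

/-! ### Path probabilities of the pair `(M₁, M₂)` -/

section GammaChain

variable {E S Ω : Type*}

variable [Fintype E] [Fintype S] [MeasurableSpace Ω] {μ : Measure Ω} {α : E → ℝ}
  {P : Matrix E E ℝ} {U : Matrix E S ℝ} {Q₁ Q₂ : Matrix S S ℝ} {M₁ M₂ : ℕ → Ω → Option (E ⊕ S)}

lemma IsCommonShockPair.measure_coord_eq_zero {x : ℕ → Option (GammaState E S)} {n : ℕ}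
    (h : IsCommonShockPair μ α P U Q₁ Q₂ M₁ M₂)
    (hx : initProb (Sum.elim α 0) (gammaCoord₁ (x 0)) * ∏ k ∈ Finset.range n,
      stepProb (fromBlocks P U 0 Q₁) (gammaCoord₁ (x k)) (gammaCoord₁ (x (k + 1))) = 0) :
    μ {ω | ∀ k ≤ n, M₁ k ω = gammaCoord₁ (x k) ∧ M₂ k ω = gammaCoord₂ (x k)} = 0 := by
  have h1 := h.chain₁.law n fun k => gammaCoord₁ (x k)
  rw [hx, ENNReal.ofReal_zero] at h1
  exact measure_mono_null (fun ω hω k hk => (hω k hk).1) h1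

variable [DecidableEq S]

/-- After leaving `E`, a path of `γ` stays outside `E`, unless one of its steps has probability zero
for both `γ` and its first coordinate. -/
lemma exists_zero_step_or_stays {x : ℕ → Option (GammaState E S)} {m n : ℕ} {a₀ b₀ : Option S}
    (hm : x m = gammaEnc a₀ b₀) :
    (∃ k < n, stepProb (PMax P U Q₁ Q₂) (x k) (x (k + 1)) = 0 ∧
      stepProb (fromBlocks P U 0 Q₁) (gammaCoord₁ (x k)) (gammaCoord₁ (x (k + 1))) = 0) ∨
    ∀ k, m ≤ k → k ≤ n → ∃ a b, x k = gammaEnc a b := by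
  by_contra! hcon
  obtain ⟨h, k, hmk, hkn, hk⟩ := hcon
  have : ∀ k, m ≤ k → k ≤ n → ∃ a b, x k = gammaEnc a b := by
    intro k hmk
    induction k, hmk using Nat.le_induction with
    | base => exact fun _ => ⟨a₀, b₀, hm⟩
    | succ k _ ih =>
      intro hkn
      obtain ⟨a, b, hab⟩ := ih (by omega)
      rcases exists_eq_inl_or_gammaEnc (x (k + 1)) with ⟨i, hi⟩ | h'
      · refine absurd ?_ (h k (by omega) ?_)
        · rw [hab, hi, gammaCoord₁_enc]
          exact stepProb_fromBlocks_inr_inl _ _ _ _ _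
        · rw [hab, hi, stepProb_PMax_enc_inl]
      · exact h'
  obtain ⟨a, b, hab⟩ := this k hmk hkn
  exact hk a b hab

/-- Before decoupling `M₂` copies `M₁`, and both matrices have the block `P` there. -/
lemma IsCommonShockPair.path_law_of_forall_inl {x : ℕ → Option (GammaState E S)} {n : ℕ}
    (h : IsCommonShockPair μ α P U Q₁ Q₂ M₁ M₂)
    (hx : ∀ k ≤ n, ∃ i, x k = some (Sum.inl (Sum.inl i))) :
    μ {ω | ∀ k ≤ n, M₁ k ω = gammaCoord₁ (x k) ∧ M₂ k ω = gammaCoord₂ (x k)} =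
      ENNReal.ofReal (initProb (gammaInit α) (x 0) *
        ∏ k ∈ Finset.range n, stepProb (PMax P U Q₁ Q₂) (x k) (x (k + 1))) := by
  have : Nonempty E := ⟨(hx 0 (Nat.zero_le n)).choose⟩
  choose! i hi using hx
  have hset : {ω | ∀ k ≤ n, M₁ k ω = gammaCoord₁ (x k) ∧ M₂ k ω = gammaCoord₂ (x k)} =ᵐ[μ]
      {ω | ∀ k ≤ n, M₁ k ω = gammaCoord₁ (x k)} := by
    rw [Filter.eventuallyEq_set]
    filter_upwards [h.agree] with ω hω
    refine ⟨fun h' k hk => (h' k hk).1, fun h' k hk => ⟨h' k hk, ?_⟩⟩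
    rw [hω k (le_decouplingTime fun l hl => ⟨i l, by rw [h' l (by omega), hi l (by omega)]; rfl⟩),
      h' k hk, hi k hk]
    rfl
  have hinit : initProb (Sum.elim α 0) (gammaCoord₁ (x 0)) = initProb (gammaInit α) (x 0) := by
    rw [hi 0 (by omega)]
    rfl
  rw [measure_congr hset, h.chain₁.law n fun k => gammaCoord₁ (x k), hinit]
  congr 2
  refine Finset.prod_congr rfl fun k hk => ?_
  have := Finset.mem_range.1 hk
  rw [hi k (by omega), hi (k + 1) (by omega)]
  rfl

lemma IsCommonShockPair.path_law_of_decoupling {x : ℕ → Option (GammaState E S)} {m r : ℕ} {j : S}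
    {i : ℕ → E} {a b : ℕ → Option S} (hparam : IsCDPHParam α P U Q₁ Q₂)
    (h : IsCommonShockPair μ α P U Q₁ Q₂ M₁ M₂)
    (hi : ∀ k < m + 1, x k = some (Sum.inl (Sum.inl (i k))))
    (hab : ∀ k ≤ r, x (m + 1 + k) = gammaEnc (a k) (b k)) (ha : a 0 = some j) (hb : b 0 = some j) :
    μ {ω | ∀ k ≤ m + 1 + r, M₁ k ω = gammaCoord₁ (x k) ∧ M₂ k ω = gammaCoord₂ (x k)} =
      ENNReal.ofReal (initProb (gammaInit α) (x 0) *
        ∏ k ∈ Finset.range (m + 1 + r), stepProb (PMax P U Q₁ Q₂) (x k) (x (k + 1))) := by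
  have hm : x (m + 1) = gammaEnc (some j) (some j) := by
    have := hab 0 (by omega)
    rwa [ha, hb] at this
  have hdec : ∀ ω, (∀ k ≤ m + 1 + r, M₁ k ω = gammaCoord₁ (x k)) →
      decouplingTime M₁ ω = ((m + 1 : ℕ) : WithTop ℕ) := fun ω hω => by
    refine decouplingTime_eq (by omega) (fun k hk => ⟨i k, ?_⟩) fun e => ?_
    · rw [hω k (by omega), hi k hk]
      rfl
    · rw [hω (m + 1) (by omega), hm]
      simp [gammaCoord₁, gammaEnc]
  have hfst : ∀ ω, (decouplingTime M₁ ω = ((m + 1 : ℕ) : WithTop ℕ) ∧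
      M₁ (m + 1) ω = some (Sum.inr j) ∧ ∀ k ≤ m + 1 + r, M₁ k ω = gammaCoord₁ (x k)) ↔
      ∀ k ≤ m + 1 + r, M₁ k ω = gammaCoord₁ (x k) := fun ω => by
    refine ⟨fun h' => h'.2.2, fun h' => ⟨hdec ω h', ?_, h'⟩⟩
    rw [h' (m + 1) (by omega), hm]
    rfl
  have hset : {ω | ∀ k ≤ m + 1 + r, M₁ k ω = gammaCoord₁ (x k) ∧ M₂ k ω = gammaCoord₂ (x k)}
      =ᵐ[μ] {ω | (decouplingTime M₁ ω = ((m + 1 : ℕ) : WithTop ℕ) ∧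
          M₁ (m + 1) ω = some (Sum.inr j) ∧ ∀ k ≤ m + 1 + r, M₁ k ω = gammaCoord₁ (x k)) ∧
        ∀ k ≤ r, M₂ (m + 1 + k) ω = (b k).map Sum.inr} := by
    rw [Filter.eventuallyEq_set]
    filter_upwards [h.agree] with ω hω
    simp only [hfst]
    refine ⟨fun h' => ⟨fun k hk => (h' k hk).1, fun k hk => ?_⟩,
      fun ⟨h1, h2⟩ k hk => ⟨h1 k hk, ?_⟩⟩
    · rw [(h' (m + 1 + k) (by omega)).2, hab k hk, gammaCoord₂_enc]
    · by_cases hkm : k < m + 1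
      · rw [hω k (by rw [hdec ω h1]; exact_mod_cast hkm.le), h1 k hk, hi k hkm]
        rfl
      · obtain ⟨l, rfl⟩ := Nat.exists_eq_add_of_le (not_lt.1 hkm)
        rw [h2 l (by omega), hab l (by omega), gammaCoord₂_enc]
  have hinit : initProb (Sum.elim α 0) (gammaCoord₁ (x 0)) = initProb (gammaInit α) (x 0) := by
    rw [hi 0 (by omega)]
    rfl
  -- The conditioning event contains the path of `M₁` up to the final time, beyond decoupling, so
  -- `M₂` contributes its `Q₂` factors as an independent product.
  rw [measure_congr hset, h.independent (m + 1) (m + 1 + r) r j (fun k => gammaCoord₁ (x k)) b hb]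
  simp only [hfst]
  rw [h.chain₁.law (m + 1 + r) fun k => gammaCoord₁ (x k), ← ENNReal.ofReal_mul]
  · congr 1
    -- Both products are split at the decoupling time. After it the factors of `M₁` and `M₂` are
    -- paired step by step into factors of `PMax`.
    rw [mul_assoc, Finset.prod_range_add _ (m + 1), Finset.prod_range_add _ (m + 1), mul_assoc,
      ← Finset.prod_mul_distrib, hinit]
    congr 2
    · refine Finset.prod_congr rfl fun k hk => ?_
      have hk' := Finset.mem_range.1 hk
      rcases Nat.lt_or_ge (k + 1) (m + 1) with hlt | hge
      · rw [hi k hk', hi (k + 1) hlt]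
        rfl
      · obtain rfl : k = m := by omega
        rw [hi k hk', hm, stepProb_PMax_inl_diag]
        rfl
    · refine Finset.prod_congr rfl fun k hk => ?_
      have hk' := Finset.mem_range.1 hk
      have hsucc := hab (k + 1) (by omega)
      rw [← add_assoc] at hsucc
      rw [hab k (by omega), hsucc, gammaCoord₁_enc, gammaCoord₁_enc, stepProb_fromBlocks_inr,
        stepProb_PMax_enc_enc]
  · refine mul_nonneg ?_ (Finset.prod_nonneg fun k _ =>
      stepProb_nonneg hparam.isSubstochastic_fromBlocks _ _)
    rw [hi 0 (by omega)]
    exact hparam.init.1 _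

/-- Paths are sorted by their first exit from `E`. Besides those that stay in `E` or exit to a
diagonal pair, all are null on both sides: starting outside `E`, returning to `E`, passing from `E`
straight to the cemetery (rows of `(P U)` sum to one), or exiting off the diagonal. -/
lemma IsCommonShockPair.path_law (hparam : IsCDPHParam α P U Q₁ Q₂)
    (h : IsCommonShockPair μ α P U Q₁ Q₂ M₁ M₂) (n : ℕ) (x : ℕ → Option (GammaState E S)) :
    μ {ω | ∀ k ≤ n, M₁ k ω = gammaCoord₁ (x k) ∧ M₂ k ω = gammaCoord₂ (x k)} =
      ENNReal.ofReal (initProb (gammaInit α) (x 0) *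
        ∏ k ∈ Finset.range n, stepProb (PMax P U Q₁ Q₂) (x k) (x (k + 1))) := by
  classical
  by_cases hall : ∀ k ≤ n, ∃ i, x k = some (Sum.inl (Sum.inl i))
  · exact h.path_law_of_forall_inl hall
  have hstep : ∀ k < n, stepProb (PMax P U Q₁ Q₂) (x k) (x (k + 1)) = 0 →
      μ {ω | ∀ k ≤ n, M₁ k ω = gammaCoord₁ (x k) ∧ M₂ k ω = gammaCoord₂ (x k)} = 0 →
      μ {ω | ∀ k ≤ n, M₁ k ω = gammaCoord₁ (x k) ∧ M₂ k ω = gammaCoord₂ (x k)} =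
      ENNReal.ofReal (initProb (gammaInit α) (x 0) *
        ∏ k ∈ Finset.range n, stepProb (PMax P U Q₁ Q₂) (x k) (x (k + 1))) := by
    intro k hk hk0 hμ
    rw [hμ, Finset.prod_eq_zero (Finset.mem_range.2 hk) hk0, mul_zero, ENNReal.ofReal_zero]
  have hstep₁ : ∀ k < n, stepProb (PMax P U Q₁ Q₂) (x k) (x (k + 1)) = 0 →
      stepProb (fromBlocks P U 0 Q₁) (gammaCoord₁ (x k)) (gammaCoord₁ (x (k + 1))) = 0 →
      μ {ω | ∀ k ≤ n, M₁ k ω = gammaCoord₁ (x k) ∧ M₂ k ω = gammaCoord₂ (x k)} =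
      ENNReal.ofReal (initProb (gammaInit α) (x 0) *
        ∏ k ∈ Finset.range n, stepProb (PMax P U Q₁ Q₂) (x k) (x (k + 1))) := by
    intro k hk hk0 hk1
    refine hstep k hk hk0 (h.measure_coord_eq_zero ?_)
    rw [Finset.prod_eq_zero (Finset.mem_range.2 hk) hk1, mul_zero]
  have hex : ∃ k, k ≤ n ∧ ¬ ∃ i, x k = some (Sum.inl (Sum.inl i)) := by
    by_contra! hcon
    exact hall hcon
  obtain ⟨m, ⟨hmn, hout⟩, hmin⟩ : ∃ m, (m ≤ n ∧ ¬ ∃ i, x m = some (Sum.inl (Sum.inl i))) ∧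
      ∀ k < m, ¬ (k ≤ n ∧ ¬ ∃ i, x k = some (Sum.inl (Sum.inl i))) :=
    ⟨Nat.find hex, Nat.find_spec hex, fun k hk => Nat.find_min hex hk⟩
  have hin : ∀ k < m, ∃ i, x k = some (Sum.inl (Sum.inl i)) := fun k hk => by
    by_contra hcon
    exact hmin k hk ⟨by omega, hcon⟩
  obtain ⟨a₀, b₀, hm⟩ := (exists_eq_inl_or_gammaEnc (x m)).resolve_left hout
  rcases m with _ | m
  · rw [h.measure_coord_eq_zero, hm, initProb_gammaInit_enc, zero_mul, ENNReal.ofReal_zero]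
    rw [hm, gammaCoord₁_enc, initProb_elim_inr, zero_mul]
  rcases exists_zero_step_or_stays (P := P) (U := U) (Q₁ := Q₁) (Q₂ := Q₂) (n := n) hm with
    ⟨k, hk, hk0, hk1⟩ | hstay
  · exact hstep₁ k hk hk0 hk1
  obtain ⟨e, he⟩ := hin m (by omega)
  by_cases hne : a₀ = b₀
  · subst hne
    rcases a₀ with _ | j
    · refine hstep₁ m (by omega) ?_ ?_
      · rw [he, hm]
        refine (stepProb_PMax_inl_none P U Q₁ Q₂ e).trans ?_
        rw [hparam.sum_row e, sub_self]
      · rw [he, hm]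
        exact hparam.exitVec_inl Q₁ e
    · obtain ⟨r, rfl⟩ := Nat.exists_eq_add_of_le hmn
      have : Nonempty E := ⟨e⟩
      choose! i hi using hin
      choose! a b hab using fun k (hk : k ≤ r) => hstay (m + 1 + k) (by omega) (by omega)
      have h0 : (gammaEnc (a 0) (b 0) : Option (GammaState E S)) = gammaEnc (some j) (some j) := by
        rw [← hab 0 (by omega), ← hm, add_zero]
      have hinj := Option.map_injective (Sum.inr_injective (α := E) (β := S))
      have ha := congrArg gammaCoord₁ h0
      have hb := congrArg gammaCoord₂ h0
      rw [gammaCoord₁_enc, gammaCoord₁_enc] at ha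
      rw [gammaCoord₂_enc, gammaCoord₂_enc] at hb
      exact h.path_law_of_decoupling hparam hi hab (hinj ha) (hinj hb)
  · refine hstep m (by omega) ?_ ?_
    · rw [he, hm, stepProb_PMax_inl_of_ne _ _ _ _ _ hne]
    -- The law of `M₁` alone need not exclude an exit off the diagonal; what excludes it is that the
    -- two processes agree up to and including the decoupling time.
    · refine measure_eq_zero_iff_ae_notMem.2 ?_
      filter_upwards [h.agree] with ω hω hmem
      have h1 := hmem (m + 1) hmn
      rw [hω (m + 1) (le_decouplingTime fun l hl => ?_), h1.1, hm, gammaCoord₁_enc,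
        gammaCoord₂_enc] at h1
      · exact hne (Option.map_injective Sum.inr_injective h1.2)
      · obtain ⟨i, hi⟩ := hin l hl
        exact ⟨i, by rw [(hmem l (by omega)).1, hi]; rfl⟩

end GammaChain

/-! ### The chain `γ` and its rewards -/

section GammaLaw

variable {E S Ω : Type*}

lemma sum_range_absorption {c : ℕ → Prop} [DecidablePred c] {t s : ℕ} (hc : ∀ n, c n ↔ t ≤ n)
    (hts : t ≤ s) : ∑ l ∈ Finset.range s, (if c l then 0 else 1) = t := by
  simp only [hc]
  obtain ⟨r, rfl⟩ := Nat.exists_eq_add_of_le hts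
  rw [Finset.sum_range_add, Finset.sum_congr rfl fun l hl => if_neg (by simpa using hl)]
  simp

lemma totalReward_gammaReward {M₁ M₂ : ℕ → Ω → Option (E ⊕ S)}
    {X : ℕ → Ω → Option (GammaState E S)} {ω : Ω} {t₁ t₂ : ℕ} (ht₁ : 1 ≤ t₁)
    (hX : ∀ n, M₁ n ω = gammaCoord₁ (X n ω) ∧ M₂ n ω = gammaCoord₂ (X n ω))
    (h₁ : ∀ n, M₁ n ω = none ↔ t₁ ≤ n) (h₂ : ∀ n, M₂ n ω = none ↔ t₂ ≤ n) :
    totalReward gammaReward₁ X ω = t₁ ∧ totalReward gammaReward₂ X ω = t₂ := by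
  classical
  have hσ : terminationTime X ω = ((max t₁ t₂ : ℕ) : WithTop ℕ) :=
    terminationTime_eq (le_max_of_le_left ht₁) fun n => by
      rw [gammaCoord_eq_none_iff, ← (hX n).1, ← (hX n).2, h₁, h₂, max_le_iff]
  unfold totalReward
  rw [hσ, untopD_cast_nat]
  simp only [elim_gammaReward₁, elim_gammaReward₂, ← (hX _).1, ← (hX _).2]
  exact ⟨sum_range_absorption h₁ (le_max_left _ _), sum_range_absorption h₂ (le_max_right _ _)⟩

variable [Fintype E] [Fintype S] [MeasurableSpace Ω] {μ : Measure Ω} {α : E → ℝ}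
  {P : Matrix E E ℝ} {U : Matrix E S ℝ} {Q₁ Q₂ : Matrix S S ℝ} {M₁ M₂ : ℕ → Ω → Option (E ⊕ S)}

lemma IsCommonShockPair.measurableSet_pair (h : IsCommonShockPair μ α P U Q₁ Q₂ M₁ M₂) (n : ℕ)
    (p : Option (E ⊕ S) × Option (E ⊕ S)) : MeasurableSet {ω | (M₁ n ω, M₂ n ω) = p} := by
  simp only [Prod.ext_iff, Set.ofPred_and]
  exact (h.chain₁.measurable n _).inter (h.measurable₂ n _)

variable [DecidableEq S]

/-- No mass is left for other pairs: the path probabilities over the paths of `γ` already sum to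
one. -/
lemma IsCommonShockPair.ae_eq_gammaCoord [IsProbabilityMeasure μ]
    (hparam : IsCDPHParam α P U Q₁ Q₂) (h : IsCommonShockPair μ α P U Q₁ Q₂ M₁ M₂) :
    ∀ᵐ ω ∂μ, ∀ n, M₁ n ω = gammaCoord₁ (gammaMerge (M₁ n ω) (M₂ n ω)) ∧
      M₂ n ω = gammaCoord₂ (gammaMerge (M₁ n ω) (M₂ n ω)) := by
  have key := ae_mem_range_of_path_law (μ := μ) (Y := fun n ω => (M₁ n ω, M₂ n ω))
    gammaCoord_injective h.measurableSet_pair (gammaInit_mem_stdSimplex hparam.init)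
    hparam.isSubstochastic_PMax fun n x => by
      simpa only [Prod.ext_iff] using h.path_law hparam n x
  filter_upwards [key] with ω hω n
  obtain ⟨g, hg⟩ := hω n
  obtain ⟨h1, h2⟩ := Prod.ext_iff.1 hg
  simp only at h1 h2
  rw [h1, h2, gammaMerge_coord]
  exact ⟨rfl, rfl⟩

lemma IsCommonShockPair.gamma_law [IsProbabilityMeasure μ] (hparam : IsCDPHParam α P U Q₁ Q₂)
    (h : IsCommonShockPair μ α P U Q₁ Q₂ M₁ M₂) (n : ℕ) (x : ℕ → Option (GammaState E S)) :
    μ {ω | ∀ k ≤ n, gammaMerge (M₁ k ω) (M₂ k ω) = x k} =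
      ENNReal.ofReal (initProb (gammaInit α) (x 0) *
        ∏ k ∈ Finset.range n, stepProb (PMax P U Q₁ Q₂) (x k) (x (k + 1))) := by
  rw [← h.path_law hparam n x]
  refine measure_congr (Filter.eventuallyEq_set.2 ?_)
  filter_upwards [h.ae_eq_gammaCoord hparam] with ω hω
  refine forall₂_congr fun k _ => ⟨fun hk => ?_, fun ⟨h1, h2⟩ => ?_⟩
  · rw [← hk]
    exact hω k
  · rw [h1, h2, gammaMerge_coord]

/-- `M₂` is not assumed to be absorbed in `none`. Absorption is inherited from `γ`, none of whose
steps of positive probability revives the second coordinate. -/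
lemma IsCommonShockPair.ae_eq_none_iff [IsProbabilityMeasure μ]
    (hparam : IsCDPHParam α P U Q₁ Q₂) (h : IsCommonShockPair μ α P U Q₁ Q₂ M₁ M₂) :
    ∀ᵐ ω ∂μ, ∃ t : ℕ, 1 ≤ t ∧ terminationTime M₂ ω = (t : WithTop ℕ) ∧
      ∀ n, M₂ n ω = none ↔ t ≤ n := by
  filter_upwards [h.terminates₂, h.ae_eq_gammaCoord hparam, h.agree,
    ae_initProb_ne_zero h.chain₁.law, ae_stepProb_ne_zero (h.gamma_law hparam)]
    with ω hterm hcoord hagree hinit hstep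
  refine eq_none_iff_of_absorbing hterm (fun h0 => hinit ?_) fun n hn => ?_
  · rw [← hagree 0 (le_decouplingTime fun k hk => absurd hk (Nat.not_lt_zero k)), h0]
    rfl
  · rw [(hcoord (n + 1)).2]
    refine gammaCoord₂_eq_none_of_stepProb_ne_zero P U Q₁ Q₂ ?_ (hstep n)
    rw [← (hcoord n).2, hn]

lemma IsCommonShockPair.isTerminatingChain_gamma [IsProbabilityMeasure μ]
    (hparam : IsCDPHParam α P U Q₁ Q₂) (h : IsCommonShockPair μ α P U Q₁ Q₂ M₁ M₂) :
    IsTerminatingChain μ (gammaInit α) (PMax P U Q₁ Q₂)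
      fun n ω => gammaMerge (M₁ n ω) (M₂ n ω) where
  measurable n x := measurableSet_of_fibers (h.measurableSet_pair n) fun p => gammaMerge p.1 p.2 = x
  law := h.gamma_law hparam
  terminates := by
    filter_upwards [h.ae_eq_gammaCoord hparam, h.chain₁.ae_eq_none_iff, h.ae_eq_none_iff hparam]
      with ω hcoord ⟨t₁, ht₁, _, h₁⟩ ⟨t₂, _, _, h₂⟩
    rw [terminationTime_eq (t := max t₁ t₂) (le_max_of_le_left ht₁) fun n => by
      rw [gammaCoord_eq_none_iff, ← (hcoord n).1, ← (hcoord n).2, h₁, h₂, max_le_iff]]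
    exact WithTop.coe_lt_top _

lemma IsCDPHLaw.isMDPHStarLaw {ν : Measure (ℝ × ℝ)} (h : IsCDPHLaw 1 2 1 2 α P U Q₁ Q₂ ν) :
    IsMDPHStarLaw (gammaInit α) (PMax P U Q₁ Q₂) gammaReward₁ gammaReward₂ ν := by
  obtain ⟨hparam, Ω, _, μ, _, M₁, M₂, hM, hlaw⟩ := h
  refine ⟨gammaInit_mem_stdSimplex hparam.init, hparam.isSubstochastic_PMax, Ω, _, μ,
    inferInstance, _, hM.isTerminatingChain_gamma hparam, hlaw.congr ?_⟩
  filter_upwards [hM.ae_eq_gammaCoord hparam, hM.chain₁.ae_eq_none_iff, hM.ae_eq_none_iff hparam]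
    with ω hcoord ⟨t₁, ht₁, hτ₁, h₁⟩ ⟨t₂, _, hτ₂, h₂⟩
  obtain ⟨hr₁, hr₂⟩ := totalReward_gammaReward
    (X := fun n ω => gammaMerge (M₁ n ω) (M₂ n ω)) ht₁ hcoord h₁ h₂
  rw [hr₁, hr₂, hτ₁, hτ₂]
  -- On the lattice `ℕ + 2` the shift is trivial, `(τ - 2) + 2 = τ`, so the rewards are the
  -- termination times themselves.
  simp only [untopD_cast_nat, one_mul, sub_add_cancel]

lemma CDPH_subset_MDPHStar : CDPH 1 2 1 2 ⊆ MDPHStar := by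
  classical
  rintro ν ⟨E, S, _, _, _, _, α, P, U, Q₁, Q₂, h⟩
  exact ⟨_, inferInstance, _, _, _, _, h.isMDPHStarLaw⟩

end GammaLaw

end PhaseType

theorem proposition2 :
    -- mDPH is contained in CDPH with support on (ℕ + 1) × (ℕ + 1)
    PhaseType.MDPH ⊆ PhaseType.CDPH 1 1 1 1 ∧
    -- CDPH with support on (ℕ + 2) × (ℕ + 2) is contained in MDPH*
    PhaseType.CDPH 1 2 1 2 ⊆ PhaseType.MDPHStar ∧
    -- the parameters that realize the first inclusion
    (∀ {S : Type*} [Fintype S] (β : S → ℝ) (Q₁ Q₂ : Matrix S S ℝ)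
      (ν : MeasureTheory.Measure (ℝ × ℝ)),
      PhaseType.IsMDPHLaw β Q₁ Q₂ ν →
      PhaseType.IsCDPHLaw 1 1 1 1 (fun _ : Unit => 1) (0 : Matrix Unit Unit ℝ)
        (Matrix.replicateRow Unit β) Q₁ Q₂ ν) ∧
    -- the chain and the rewards that realize the second inclusion
    (∀ {E S : Type*} [Fintype E] [Fintype S] [DecidableEq S] (α : E → ℝ) (P : Matrix E E ℝ)
      (U : Matrix E S ℝ) (Q₁ Q₂ : Matrix S S ℝ) (ν : MeasureTheory.Measure (ℝ × ℝ)),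
      PhaseType.IsCDPHLaw 1 2 1 2 α P U Q₁ Q₂ ν →
      PhaseType.IsMDPHStarLaw (PhaseType.gammaInit α) (PhaseType.PMax P U Q₁ Q₂)
        PhaseType.gammaReward₁ PhaseType.gammaReward₂ ν) := by
  exact ⟨PhaseType.MDPH_subset_CDPH, PhaseType.CDPH_subset_MDPHStar,
    fun _ _ _ _ h => h.isCDPHLaw, fun _ _ _ _ _ _ h => h.isMDPHStarLaw⟩
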